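/- Let $c\in\mathbb R\setminus\{0\}$. Consider traveling waves $u(t,x)=\varphi(\xi)$, $\xi=x-ct$, of $u_t=u_{xx}+u^{-1}$, i.e. positive $C^2$ solutions, on an interval $(a,\xi_{\max})$ with $\xi_{\max}<\infty$, of $$\varphi'=\psi,\qquad \psi'=-c\psi-\varphi^{-1}.$$ Such a wave is called quenching if $\varphi(\xi)\to 0$ and $\psi(\xi)\to-\infty$ as $\xi\to\xi_{\max}-0$. With $\varphi=x/\lambda$, $\psi=-1/\lambda$ and $d\tau/d\xi=\varphi^{-1}\lambda^{-1}$, the equations become the desingularized system $$\frac{d\lambda}{d\tau}=cx\lambda-\lambda^3,\qquad \frac{dx}{d\tau}=-x+x(cx-\lambda^2).\tag{$*$}$$ Let $p_0=(\lambda,x)=(0,0)$ and let $W^{cs}(p_0)$ be the set of initial data whose trajectories under $(*)$ exist for all $\tau\ge 0$ and tend to $p_0$ as $\tau\to\infty$. Then: (1) $p_0$ is a semi-hyperbolic equilibrium of $(*)$ (exactly one eigenvalue of the linearization is zero), and $W^{cs}(p_0)$ is a center-stable manifold of $p_0$: near $p_0$ it is a $C^1$ manifold tangent at $p_0$ to the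 sum of the center and the stable subspace, and it is locally invariant. Every center-stable manifold of $p_0$ coincides with it near $p_0$. (2) If $c<0$, a traveling wave on $(a,\xi_{\max})$ is quenching if and only if $u(t,x)=\varphi(x-ct)$ quenches at every point $(T,x_0)$ with $x_0-cT=\xi_{\max}$, i.e. $u(t,x_0)\to0$ and $u_t(t,x_0)\to-\infty$ as $t\to T-0$. (3) The quenching traveling waves are exactly those given by trajectories of $(*)$ with initial data on $W^{cs}(p_0)\cap\{\lambda>0,\ x>0\}$. That is, if $\varphi$ is quenching and $\xi_1\in(a,\xi_{\max})$ with $\psi(\xi_1)<0$, then $\varphi$ on $(\xi_1,\xi_{\max})$ corresponds, through the above change of variables, to a trajectory of $(*)$ on $0<\tau<\infty$ with initial point $(-1/\psi(\xi_1),-\varphi(\xi_1)/\psi(\xi_1))\in W^{cs}(p_0)$ that tends to $p_0$. Conversely, for every trajectory of $(*)$ on $[0,\infty)$ with initial point in $W^{cs}(p_0)\cap\{\lambda>0,\ x>0\}$ and every $\xi_1\in\mathbb R$ there are a finite $\xi_{\max}>\xi_1$ and a quenching traveling wave on $(\xi_1,\xi_{\max})$ that corresponds to it. (4) For every quenching traveling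 wave there is a constant $C>0$ such that, as $\xi\to\xi_{\max}-0$, $$\varphi(\xi)\sim C(\xi_{\max}-\xi)\bigl(\ln(\xi_{\max}-\xi)^{-1}\bigr)^{1/2},\qquad \psi(\xi)\sim -C\bigl(\ln(\xi_{\max}-\xi)^{-1}\bigr)^{1/2}.$$ -/

import Mathlib

open Set Filter Topology Asymptotics Polynomial

namespace QuenchingWave

/-! ### Equilibria of vector fields and their center-stable manifolds -/

section General

variable {E : Type*} [NormedAddCommGroup E] [NormedSpace ℝ E]

/-- `γ` solves `dγ/dτ = g(γ)` on the time set `s` (one-sided derivatives at end points of `s`). -/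
def IsTrajectoryOn (g : E → E) (γ : ℝ → E) (s : Set ℝ) : Prop :=
  IsIntegralCurveOn γ (fun _ => g) s

/-- Semi-hyperbolic equilibrium: exactly one eigenvalue of the linearization (counted with
algebraic multiplicity) is equal to zero. -/
def IsSemiHyperbolic [FiniteDimensional ℝ E] (g : E → E) (p : E) : Prop :=
  g p = 0 ∧ ContDiffAt ℝ 1 g p ∧
    (LinearMap.charpoly (fderiv ℝ g p : E →ₗ[ℝ] E)).rootMultiplicity 0 = 1

/-- The center-stable subspace `E^c ⊕ E^s` of a linear map `A` of a finite-dimensional real space: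
the span of the kernels of all `P(A)`, where `P` is a nonzero real polynomial whose complex roots
all have nonpositive real part (the real generalized eigenspace of the eigenvalues with `Re ≤ 0`). -/
noncomputable def centerStableSubspace (A : E →ₗ[ℝ] E) : Submodule ℝ E :=
  ⨆ (P : ℝ[X]) (_ : P ≠ 0) (_ : ∀ z : ℂ, aeval z P = 0 → z.re ≤ 0), LinearMap.ker (aeval A P)

/-- `W` is a (local) center-stable manifold of the equilibrium `p` of `g`: near `p` it is the graph
of a `C¹` map `h` over the center-stable subspace of the linearization, tangent to that subspace at
`p`, and it is locally invariant, i.e. a trajectory starting in `W` stays in `W` for as long as it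
stays in a fixed neighborhood of `p`. -/
def IsCenterStableManifold (g : E → E) (p : E) (W : Set E) : Prop :=
  g p = 0 ∧ p ∈ W ∧
  (∃ (Q : Submodule ℝ E)
      (h : centerStableSubspace (fderiv ℝ g p : E →ₗ[ℝ] E) → Q),
    IsCompl (centerStableSubspace (fderiv ℝ g p : E →ₗ[ℝ] E)) Q ∧
    ContDiffAt ℝ 1 h 0 ∧ h 0 = 0 ∧ fderiv ℝ h 0 = 0 ∧
    ∀ᶠ q in 𝓝 p, q ∈ W ↔
      ∃ v : centerStableSubspace (fderiv ℝ g p : E →ₗ[ℝ] E), q = p + (v : E) + (h v : E)) ∧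
  (∃ U ∈ 𝓝 p, ∀ (γ : ℝ → E) (T : ℝ), 0 ≤ T → IsTrajectoryOn g γ (Icc 0 T) →
    γ 0 ∈ W → (∀ τ ∈ Icc 0 T, γ τ ∈ U) → ∀ τ ∈ Icc 0 T, γ τ ∈ W)

/-- The set of initial data whose trajectory exists for all `τ ≥ 0` and is asymptotic to `p`. -/
def asymptoticSet (g : E → E) (p : E) : Set E :=
  {q | ∃ γ : ℝ → E, IsTrajectoryOn g γ (Ici 0) ∧ γ 0 = q ∧ Tendsto γ atTop (𝓝 p)}

end General

/-! ### The desingularized system -/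

/-- The desingularized vector field in the variables `(l, x)`:
`dl/dτ = c x l - l³`, `dx/dτ = -x + x (c x - l²)`. -/
def desingField (c : ℝ) (q : ℝ × ℝ) : ℝ × ℝ :=
  (c * q.2 * q.1 - q.1 ^ 3, -q.2 + q.2 * (c * q.2 - q.1 ^ 2))

/-- The equilibrium `(l, x) = (0, 0)` at infinity. -/
def p₀ : ℝ × ℝ := (0, 0)

/-- The center-stable manifold `W^{cs}(p₀)` of the desingularized field: all initial data whose
trajectories are asymptotic to `p₀`. (The linearization at `p₀` has no eigenvalue with positive real
part; that this set is a center-stable manifold in the sense of `IsCenterStableManifold`, and the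
only one near `p₀`, is part of the theorem.) -/
def Wcs (c : ℝ) : Set (ℝ × ℝ) := asymptoticSet (desingField c) p₀

/-! ### Traveling waves and quenching -/

/-- `u` satisfies `u_t = u_xx + u⁻¹` at every point of `D`. -/
def SolvesHeatOn (u : ℝ → ℝ → ℝ) (D : Set (ℝ × ℝ)) : Prop :=
  ∀ q ∈ D, deriv (fun t => u t q.2) q.1 =
    iteratedDeriv 2 (fun x => u q.1 x) q.2 + (u q.1 q.2)⁻¹

/-- `u` quenches at `(T, x₀)`. -/
def QuenchesAt (u : ℝ → ℝ → ℝ) (T x₀ : ℝ) : Prop :=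
  Tendsto (fun t => u t x₀) (𝓝[<] T) (𝓝 0) ∧
  Tendsto (fun t => deriv (fun s => u s x₀) t) (𝓝[<] T) atBot

/-- `φ` is the profile, on `a < ξ < b`, of a positive classical traveling wave
`u(t,x) = φ(x - c t)` of `u_t = u_xx + u⁻¹`. -/
structure IsTravelingWave (c : ℝ) (φ : ℝ → ℝ) (a b : ℝ) : Prop where
  lt : a < b
  smooth : ContDiffOn ℝ 2 φ (Ioo a b)
  pos : ∀ ξ ∈ Ioo a b, 0 < φ ξ
  solves : SolvesHeatOn (fun t x => φ (x - c * t)) {q | q.2 - c * q.1 ∈ Ioo a b}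

/-- The traveling wave quenches at the finite end `ξmax` of its interval: there `φ` becomes
extinct and `ψ = φ'` blows up to `-∞`. -/
structure IsQuenchingWave (c : ℝ) (φ : ℝ → ℝ) (a ξmax : ℝ) : Prop
    extends IsTravelingWave c φ a ξmax where
  extinction : Tendsto φ (𝓝[<] ξmax) (𝓝 0)
  blowup : Tendsto (deriv φ) (𝓝[<] ξmax) atBot

/-- The part of the wave profile on `ξ₁ < ξ < ξmax` is the image of the trajectory
`γ = (l, x)`, `0 < τ < ∞`, under `φ = x / l`, `ψ = φ' = -1 / l` and the change of the independent
variable `dτ/dξ = φ⁻¹ l⁻¹` (the composition of `ds/dξ = φ⁻¹` and `dτ/ds = l⁻¹`). -/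
structure Corresponds (φ : ℝ → ℝ) (ξ₁ ξmax : ℝ) (γ : ℝ → ℝ × ℝ) (τ : ℝ → ℝ) : Prop where
  l_pos : ∀ ξ ∈ Ioo ξ₁ ξmax, 0 < (γ (τ ξ)).1
  phi_eq : ∀ ξ ∈ Ioo ξ₁ ξmax, φ ξ = (γ (τ ξ)).2 / (γ (τ ξ)).1
  psi_eq : ∀ ξ ∈ Ioo ξ₁ ξmax, deriv φ ξ = -1 / (γ (τ ξ)).1
  time : ∀ ξ ∈ Ioo ξ₁ ξmax, HasDerivAt τ ((φ ξ)⁻¹ * ((γ (τ ξ)).1)⁻¹) ξ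
  start : Tendsto τ (𝓝[>] ξ₁) (𝓝 0)
  stop_time : Tendsto τ (𝓝[<] ξmax) atTop

end QuenchingWave

open QuenchingWave

namespace QuenchingWave

/-! The linearization at `p₀` is diag(0, -1), so the center-stable subspace is the whole plane and a
center-stable manifold of `p₀` is, near `p₀`, just a neighborhood. Part (1) therefore amounts to
asymptotic stability: with V = λ² + 2c²x² one has V' ≤ -V²/2 wherever |cx| ≤ 1/2
(`lyapunovDeriv_le`), which makes `Wcs c` a neighborhood (`Wcs_mem_nhds`).

The correspondence in (3) is explicit because (x/λ)' = -x/λ along (*): φ decays exactly like e^{-τ},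
so τ equals -ln φ up to a constant. From a wave, this τ is inverted to get the trajectory; from a
trajectory, ξ is recovered from dξ/dτ = x, and ξmax is finite because x = r e^{-τ} λ is integrable.

The rates (4) need no center manifold expansion. Since (e^{2cξ}ψ²)' = 2e^{2cξ}(-ln φ)', L'Hôpital's
rule gives ψ² ~ -2 ln φ. It also gives -φ/ψ ~ ξmax - ξ, and taking logarithms, -ln φ ~ ln(ξmax -
ξ)⁻¹. Hence C = √2 for every wave. Part (2) is the chain rule: u_t = -cψ with -c > 0. -/

/-! ### The profile equation -/

/-- Along a traveling wave, `φ` is differentiable and `ψ = φ'` solves `ψ' = -c ψ - φ⁻¹`. -/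
theorem IsTravelingWave.hasDerivAt {c : ℝ} {φ : ℝ → ℝ} {a b : ℝ} (h : IsTravelingWave c φ a b)
    {ξ : ℝ} (hξ : ξ ∈ Ioo a b) :
    HasDerivAt φ (deriv φ ξ) ξ ∧
      HasDerivAt (deriv φ) (-c * deriv φ ξ - (φ ξ)⁻¹) ξ := by
  have hC : ContDiffAt ℝ 2 φ ξ := h.smooth.contDiffAt (isOpen_Ioo.mem_nhds hξ)
  have h1 : DifferentiableAt ℝ φ ξ := hC.differentiableAt (by norm_num)
  have h2 : DifferentiableAt ℝ (deriv φ) ξ := by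
    have hs := h.smooth
    rw [show (2 : WithTop ℕ∞) = 1 + 1 by norm_num,
      contDiffOn_succ_iff_deriv_of_isOpen isOpen_Ioo] at hs
    exact (hs.2.2.contDiffAt (isOpen_Ioo.mem_nhds hξ)).differentiableAt (by norm_num)
  refine ⟨h1.hasDerivAt, ?_⟩
  have hs := h.solves (0, ξ) (by simpa using hξ)
  have ht : HasDerivAt (fun t => φ (ξ - c * t)) (deriv φ ξ * (-c)) 0 := by
    have e : HasDerivAt (fun t : ℝ => ξ - c * t) (-c) 0 := by
      simpa using ((hasDerivAt_id (0 : ℝ)).const_mul c).const_sub ξ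
    have e1 : HasDerivAt φ (deriv φ ξ) (ξ - c * 0) := by simpa using h1.hasDerivAt
    exact e1.comp (0 : ℝ) e
  simp only [ht.deriv, mul_zero, sub_zero, iteratedDeriv_succ, iteratedDeriv_zero] at hs
  have := h2.hasDerivAt
  rwa [show deriv (deriv φ) ξ = -c * deriv φ ξ - (φ ξ)⁻¹ by linarith] at this

/-- A positive solution of the first-order system is a traveling wave. -/
theorem isTravelingWave_of_hasDerivAt {c : ℝ} {φ ψ : ℝ → ℝ} {a b : ℝ} (hab : a < b)
    (hpos : ∀ ξ ∈ Ioo a b, 0 < φ ξ) (hφ : ∀ ξ ∈ Ioo a b, HasDerivAt φ (ψ ξ) ξ)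
    (hψ : ∀ ξ ∈ Ioo a b, HasDerivAt ψ (-c * ψ ξ - (φ ξ)⁻¹) ξ) :
    IsTravelingWave c φ a b := by
  have hd : ∀ ξ ∈ Ioo a b, deriv φ ξ = ψ ξ := fun ξ hξ => (hφ ξ hξ).deriv
  have hd2 : ∀ ξ ∈ Ioo a b, HasDerivAt (deriv φ) (-c * ψ ξ - (φ ξ)⁻¹) ξ := fun ξ hξ =>
    (hψ ξ hξ).congr_of_eventuallyEq (by
      filter_upwards [isOpen_Ioo.mem_nhds hξ] with y hy using hd y hy)
  have hcont : ContinuousOn (fun ξ => -c * ψ ξ - (φ ξ)⁻¹) (Ioo a b) := by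
    intro ξ hξ
    exact (((hψ ξ hξ).continuousAt.const_mul (-c)).sub
      ((hφ ξ hξ).continuousAt.inv₀ (hpos ξ hξ).ne')).continuousWithinAt
  refine ⟨hab, ?_, hpos, ?_⟩
  · rw [show (2 : WithTop ℕ∞) = 1 + 1 by norm_num, contDiffOn_succ_iff_deriv_of_isOpen isOpen_Ioo]
    refine ⟨fun ξ hξ => (hφ ξ hξ).differentiableAt.differentiableWithinAt, by simp, ?_⟩
    rw [show (1 : WithTop ℕ∞) = 0 + 1 by norm_num, contDiffOn_succ_iff_deriv_of_isOpen isOpen_Ioo]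
    refine ⟨fun ξ hξ => (hd2 ξ hξ).differentiableAt.differentiableWithinAt, by simp, ?_⟩
    rw [contDiffOn_zero]
    exact hcont.congr fun ξ hξ => (hd2 ξ hξ).deriv
  · rintro ⟨t, x⟩ hq
    have hξ : x - c * t ∈ Ioo a b := hq
    have ht : HasDerivAt (fun s => φ (x - c * s)) (ψ (x - c * t) * (-c)) t := by
      have e : HasDerivAt (fun s : ℝ => x - c * s) (-c) t := by
        simpa using ((hasDerivAt_id t).const_mul c).const_sub x
      exact (hφ _ hξ).comp t e
    simp only [ht.deriv, iteratedDeriv_succ, iteratedDeriv_zero]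
    have e1 : deriv (fun y => φ (y - c * t)) = fun y => deriv φ (y - c * t) := by
      funext y; exact deriv_comp_sub_const ..
    rw [e1, deriv_comp_sub_const, (hd2 _ hξ).deriv]
    ring

/-! ### Differentiable inverses -/

/-- A function with positive derivative on an open interval has a differentiable inverse. -/
theorem exists_hasDerivAt_inverse {S : Set ℝ} (hS : IsOpen S) (hS' : S.OrdConnected)
    {f f' : ℝ → ℝ} (hf : ∀ s ∈ S, HasDerivAt f (f' s) s) (hf' : ∀ s ∈ S, 0 < f' s) :
    StrictMonoOn f S ∧ ∃ g : ℝ → ℝ, (∀ s ∈ S, g (f s) = s) ∧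
      ∀ s ∈ S, HasDerivAt g (f' s)⁻¹ (f s) := by
  have hcont : ContinuousOn f S := fun s hs => (hf s hs).continuousAt.continuousWithinAt
  have hmono : StrictMonoOn f S := by
    apply strictMonoOn_of_deriv_pos hS'.convex hcont
    intro s hs
    rw [hS.interior_eq] at hs
    rw [(hf s hs).deriv]; exact hf' s hs
  have hg : ∀ s ∈ S, Function.invFunOn f S (f s) = s := fun s hs =>
    hmono.injOn.leftInvOn_invFunOn hs
  refine ⟨hmono, Function.invFunOn f S, hg, fun s hs => ?_⟩
  have himg : f '' S ∈ 𝓝 (f s) := by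
    obtain ⟨u, v, hs1, hs2⟩ := mem_nhds_iff_exists_Ioo_subset.1 (hS.mem_nhds hs)
    obtain ⟨u', hu1, hu2⟩ := exists_between hs1.1
    obtain ⟨v', hv1, hv2⟩ := exists_between hs1.2
    have hu : u' ∈ S := hs2 ⟨hu1, hu2.trans hs1.2⟩
    have hv : v' ∈ S := hs2 ⟨hs1.1.trans hv1, hv2⟩
    have hsub : Icc u' v' ⊆ S := hS'.out hu hv
    refine mem_of_superset (Icc_mem_nhds (hmono hu hs hu2) (hmono hs hv hv1)) ?_
    exact (intermediate_value_Icc (hu2.trans hv1).le (hcont.mono hsub)).trans (image_mono hsub)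
  have hgm : StrictMonoOn (Function.invFunOn f S) (f '' S) := by
    rintro _ ⟨x, hx, rfl⟩ _ ⟨y, hy, rfl⟩ hxy
    rw [hg x hx, hg y hy]
    exact (hmono.lt_iff_lt hx hy).1 hxy
  have hgi : Function.invFunOn f S '' (f '' S) ∈ 𝓝 (Function.invFunOn f S (f s)) := by
    rw [hg s hs]
    refine mem_of_superset (hS.mem_nhds hs) fun x hx => ⟨f x, ⟨x, hx, rfl⟩, hg x hx⟩
  have hgc : ContinuousAt (Function.invFunOn f S) (f s) :=
    hgm.continuousAt_of_image_mem_nhds himg hgi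
  refine HasDerivAt.of_local_left_inverse (f := f) hgc ?_ (hf' s hs).ne' ?_
  · rw [hg s hs]; exact hf s hs
  · filter_upwards [himg]
    rintro _ ⟨x, hx, rfl⟩
    rw [hg x hx]

/-! ### L'Hôpital's rule at infinity -/

/-- If `f' ≤ M g'` near `b` and `g → ∞` at `b`, then `f / g` is eventually below any `M' > M`. -/
theorem eventually_div_lt_of_deriv_le {f g f' g' : ℝ → ℝ} {b M M' : ℝ}
    (hf : ∀ᶠ x in 𝓝[<] b, HasDerivAt f (f' x) x) (hg : ∀ᶠ x in 𝓝[<] b, HasDerivAt g (g' x) x)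
    (hle : ∀ᶠ x in 𝓝[<] b, f' x ≤ M * g' x) (hgt : Tendsto g (𝓝[<] b) atTop) (hM : M < M') :
    ∀ᶠ x in 𝓝[<] b, f x / g x < M' := by
  obtain ⟨u, hu, hsub⟩ := mem_nhdsLT_iff_exists_Ioo_subset.1 (hf.and (hg.and hle))
  obtain ⟨u', hu1, hu2⟩ := exists_between (show u < b from hu)
  have hd : ∀ x ∈ Ico u' b, HasDerivAt (fun y => f y - M * g y) (f' x - M * g' x) x :=
    fun x hx => by
      obtain ⟨h1, h2, -⟩ := hsub ⟨hu1.trans_le hx.1, hx.2⟩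
      exact h1.sub (h2.const_mul M)
  have hanti : AntitoneOn (fun y => f y - M * g y) (Ico u' b) := by
    apply antitoneOn_of_deriv_nonpos (convex_Ico _ _)
      (fun x hx => (hd x hx).continuousAt.continuousWithinAt)
    · intro x hx
      rw [interior_Ico] at hx
      exact (hd x (Ioo_subset_Ico_self hx)).differentiableAt.differentiableWithinAt
    · intro x hx
      rw [interior_Ico] at hx
      rw [(hd x (Ioo_subset_Ico_self hx)).deriv]
      have := (hsub ⟨hu1.trans hx.1, hx.2⟩).2.2
      linarith
  -- f - M g stays below its value K at u'; the threshold K / (M' - M) for g is what turns f ≤ K + M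
  -- g into f < M' g.
  have hK := hgt.eventually_gt_atTop (max 0 ((f u' - M * g u') / (M' - M)))
  filter_upwards [hK, Ioo_mem_nhdsLT hu2] with x hx hxm
  have h0 : 0 < g x := (le_max_left _ _).trans_lt hx
  have h1 : (f u' - M * g u') / (M' - M) < g x := (le_max_right _ _).trans_lt hx
  have h2 : f x - M * g x ≤ f u' - M * g u' :=
    hanti ⟨le_rfl, hu2⟩ ⟨hxm.1.le, hxm.2⟩ hxm.1.le
  rw [div_lt_iff₀ (by linarith)] at h1
  rw [div_lt_iff₀ h0]
  linarith

/-- **L'Hôpital's rule** for approaching a real from the left, denominator tending to infinity. -/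
theorem lhopital_atTop_nhdsLT {f g f' g' : ℝ → ℝ} {b L : ℝ}
    (hf : ∀ᶠ x in 𝓝[<] b, HasDerivAt f (f' x) x) (hg : ∀ᶠ x in 𝓝[<] b, HasDerivAt g (g' x) x)
    (hg' : ∀ᶠ x in 𝓝[<] b, 0 < g' x) (hgt : Tendsto g (𝓝[<] b) atTop)
    (hdiv : Tendsto (fun x => f' x / g' x) (𝓝[<] b) (𝓝 L)) :
    Tendsto (fun x => f x / g x) (𝓝[<] b) (𝓝 L) := by
  rw [tendsto_order]
  constructor
  · intro m hm
    obtain ⟨m', h1, h2⟩ := exists_between hm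
    have hle : ∀ᶠ x in 𝓝[<] b, -f' x ≤ -m' * g' x := by
      filter_upwards [hdiv.eventually_const_lt h2, hg'] with x hx hx'
      rw [lt_div_iff₀ hx'] at hx
      linarith
    filter_upwards [eventually_div_lt_of_deriv_le (f := fun x => -f x)
      (hf.mono fun x hx => hx.neg) hg hle hgt (neg_lt_neg h1)] with x hx
    rw [neg_div] at hx
    linarith
  · intro m hm
    obtain ⟨m', h1, h2⟩ := exists_between hm
    refine eventually_div_lt_of_deriv_le hf hg ?_ hgt h2
    filter_upwards [hdiv.eventually_lt_const h1, hg'] with x hx hx'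
    rw [div_lt_iff₀ hx'] at hx
    exact hx.le

/-! ### Quenching rates -/

section Rates

variable {c : ℝ} {φ : ℝ → ℝ} {a ξmax : ℝ}

theorem IsQuenchingWave.eventually_mem (h : IsQuenchingWave c φ a ξmax) :
    ∀ᶠ ξ in 𝓝[<] ξmax, ξ ∈ Ioo a ξmax ∧ deriv φ ξ < 0 :=
  (eventually_of_mem (Ioo_mem_nhdsLT h.lt) fun _ hx => hx).and (h.blowup.eventually_lt_atBot 0)

theorem IsQuenchingWave.tendsto_neg_log (h : IsQuenchingWave c φ a ξmax) :
    Tendsto (fun ξ => -Real.log (φ ξ)) (𝓝[<] ξmax) atTop := by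
  refine tendsto_neg_atBot_atTop.comp (Real.tendsto_log_nhdsGT_zero.comp ?_)
  exact tendsto_nhdsWithin_iff.2
    ⟨h.extinction, h.eventually_mem.mono fun ξ hξ => h.pos ξ hξ.1⟩

theorem IsQuenchingWave.hasDerivAt_neg_log (h : IsQuenchingWave c φ a ξmax) {ξ : ℝ}
    (hξ : ξ ∈ Ioo a ξmax) :
    HasDerivAt (fun ξ => -Real.log (φ ξ)) (-(deriv φ ξ / φ ξ)) ξ :=
  ((h.toIsTravelingWave.hasDerivAt hξ).1.log (h.pos ξ hξ).ne').neg

/-- `ψ² ~ -2 ln φ` at the quenching point. -/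
theorem IsQuenchingWave.tendsto_sq_div_log (h : IsQuenchingWave c φ a ξmax) :
    Tendsto (fun ξ => deriv φ ξ ^ 2 / (-Real.log (φ ξ))) (𝓝[<] ξmax) (𝓝 2) := by
  have hexp : ∀ k : ℝ, Tendsto (fun ξ => Real.exp (k * ξ)) (𝓝[<] ξmax)
      (𝓝 (Real.exp (k * ξmax))) := fun k =>
    ((by fun_prop : Continuous fun ξ => Real.exp (k * ξ)).tendsto ξmax).mono_left
      nhdsWithin_le_nhds
  -- The weight e^{2cξ} cancels the term -2cψ² in (ψ²)', leaving -2e^{2cξ}ψ/φ, whose quotient by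
  -- (-ln φ)' = -ψ/φ is 2e^{2cξ}.
  have key : Tendsto (fun ξ => (Real.exp (2 * c * ξ) * deriv φ ξ ^ 2) / (-Real.log (φ ξ)))
      (𝓝[<] ξmax) (𝓝 (2 * Real.exp (2 * c * ξmax))) := by
    refine lhopital_atTop_nhdsLT
      (f' := fun ξ => Real.exp (2 * c * ξ) * (-2 * (deriv φ ξ / φ ξ)))
      (g' := fun ξ => -(deriv φ ξ / φ ξ)) ?_ ?_ ?_ h.tendsto_neg_log ?_
    · filter_upwards [h.eventually_mem] with ξ hξ
      have h2 := (h.toIsTravelingWave.hasDerivAt hξ.1).2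
      have h3 : HasDerivAt (fun ξ => Real.exp (2 * c * ξ)) (Real.exp (2 * c * ξ) * (2 * c)) ξ := by
        simpa using ((hasDerivAt_id ξ).const_mul (2 * c)).exp
      refine (h3.mul (h2.pow 2)).congr_deriv ?_
      have := (h.pos ξ hξ.1).ne'
      simp only [Pi.pow_apply]
      field_simp
      ring
    · filter_upwards [h.eventually_mem] with ξ hξ using h.hasDerivAt_neg_log hξ.1
    · filter_upwards [h.eventually_mem] with ξ hξ
      have := div_neg_of_neg_of_pos hξ.2 (h.pos ξ hξ.1)
      linarith
    · refine ((hexp (2 * c)).const_mul 2).congr' ?_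
      filter_upwards [h.eventually_mem] with ξ hξ
      have := hξ.2.ne
      have := (h.pos ξ hξ.1).ne'
      field_simp
  have := key.mul (hexp (-(2 * c)))
  rw [mul_assoc, ← Real.exp_add, neg_mul, add_neg_cancel, Real.exp_zero, mul_one] at this
  refine this.congr fun ξ => ?_
  have e : Real.exp (2 * c * ξ) * Real.exp (-(2 * c) * ξ) = 1 := by
    rw [← Real.exp_add]; simp
  calc _ = (Real.exp (2 * c * ξ) * Real.exp (-(2 * c) * ξ)) *
        (deriv φ ξ ^ 2 / (-Real.log (φ ξ))) := by ring
    _ = _ := by rw [e, one_mul]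

theorem IsQuenchingWave.tendsto_inv_deriv (h : IsQuenchingWave c φ a ξmax) :
    Tendsto (fun ξ => (deriv φ ξ)⁻¹) (𝓝[<] ξmax) (𝓝 0) :=
  tendsto_inv_atBot_zero.comp h.blowup

/-- `-φ / ψ ~ ξmax - ξ` at the quenching point. -/
theorem IsQuenchingWave.tendsto_div_dist (h : IsQuenchingWave c φ a ξmax) :
    Tendsto (fun ξ => (-φ ξ / deriv φ ξ) / (ξmax - ξ)) (𝓝[<] ξmax) (𝓝 1) := by
  have hi := h.tendsto_inv_deriv
  -- By the profile equation (-φ/ψ)' = -1 - cφ/ψ - 1/ψ², which tends to -1, the derivative of ξmax -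
  -- ξ.
  refine HasDerivAt.lhopital_zero_nhdsLT
    (f' := fun ξ => -1 - c * (φ ξ * (deriv φ ξ)⁻¹) - ((deriv φ ξ)⁻¹) ^ 2)
    (g' := fun _ => -1) ?_ ?_ (by simp) ?_ ?_ ?_
  · filter_upwards [h.eventually_mem] with ξ hξ
    obtain ⟨h1, h2⟩ := h.toIsTravelingWave.hasDerivAt hξ.1
    refine (h1.neg.div h2 hξ.2.ne).congr_deriv ?_
    have := (h.pos ξ hξ.1).ne'
    have := hξ.2.ne
    simp only [Pi.neg_apply]
    field_simp
    ring
  · exact Eventually.of_forall fun ξ => by simpa using (hasDerivAt_id ξ).const_sub ξmax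
  · simpa [div_eq_mul_inv] using h.extinction.neg.mul hi
  · have : Continuous fun ξ : ℝ => ξmax - ξ := by fun_prop
    simpa using (this.tendsto ξmax).mono_left (nhdsWithin_le_nhds (s := Iio ξmax))
  · have := (((h.extinction.mul hi).const_mul c).const_sub (-1)).sub (hi.pow 2)
    simpa using this.div_const (-1)

/-- `ln (ξmax - ξ)⁻¹ ~ -ln φ` at the quenching point. -/
theorem IsQuenchingWave.tendsto_log_div_log (h : IsQuenchingWave c φ a ξmax) :
    Tendsto (fun ξ => Real.log (ξmax - ξ)⁻¹ / (-Real.log (φ ξ))) (𝓝[<] ξmax) (𝓝 1) := by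
  have hL := h.tendsto_neg_log
  have h1 : Tendsto (fun ξ => Real.log ((-φ ξ / deriv φ ξ) / (ξmax - ξ)) / (-Real.log (φ ξ)))
      (𝓝[<] ξmax) (𝓝 0) :=
    (h.tendsto_div_dist.log one_ne_zero).div_atTop hL
  have h2 : Tendsto (fun ξ => Real.log (deriv φ ξ ^ 2) / (deriv φ ξ ^ 2)) (𝓝[<] ξmax) (𝓝 0) := by
    have hsq : Tendsto (fun ξ => deriv φ ξ ^ 2) (𝓝[<] ξmax) atTop := by
      have := h.blowup.atBot_mul_atBot₀ h.blowup
      simpa [sq] using this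
    exact (Real.isLittleO_log_id_atTop.tendsto_div_nhds_zero).comp hsq
  -- ln(ξmax - ξ)⁻¹ is -ln φ plus the logarithm of a ratio tending to 1 plus ½ ln ψ². The last term
  -- is negligible because ln ψ² = o(ψ²) and ψ² is comparable to -ln φ.
  have h3 := ((h2.mul h.tendsto_sq_div_log).mul_const (1 / 2)).add (h1.add_const 1)
  simp only [zero_mul, zero_add] at h3
  refine h3.congr' ?_
  filter_upwards [h.eventually_mem, hL.eventually_gt_atTop 0] with ξ hξ hξ0
  have hφ := h.pos ξ hξ.1
  have hd : 0 < ξmax - ξ := sub_pos.2 hξ.1.2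
  have hψ := hξ.2
  have e : Real.log ((-φ ξ / deriv φ ξ) / (ξmax - ξ)) =
      Real.log (φ ξ) - Real.log (deriv φ ξ) + Real.log (ξmax - ξ)⁻¹ := by
    rw [Real.log_div (div_ne_zero (neg_ne_zero.2 hφ.ne') hψ.ne) hd.ne',
      Real.log_div (neg_ne_zero.2 hφ.ne') hψ.ne, Real.log_neg_eq_log, Real.log_inv]
    ring
  rw [e, Real.log_pow]
  have := hξ0.ne'
  have := hψ.ne
  have : Real.log (φ ξ) ≠ 0 := by intro h0; simp [h0] at hξ0
  field_simp
  push_cast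
  ring

/-- Dividing the two logarithmic asymptotics gives ψ² ~ 2 ln(ξmax - ξ)⁻¹, hence ψ with C = √2; φ
then follows from φ ~ -ψ (ξmax - ξ). -/
theorem IsQuenchingWave.isEquivalent (h : IsQuenchingWave c φ a ξmax) :
    ∃ C : ℝ, 0 < C ∧
      φ ~[𝓝[<] ξmax] (fun ξ => C * (ξmax - ξ) * (Real.log (ξmax - ξ)⁻¹) ^ (1 / 2 : ℝ)) ∧
      deriv φ ~[𝓝[<] ξmax] (fun ξ => -C * (Real.log (ξmax - ξ)⁻¹) ^ (1 / 2 : ℝ)) := by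
  have hL := h.tendsto_neg_log
  have h1 : Tendsto (fun ξ => deriv φ ξ ^ 2 / Real.log (ξmax - ξ)⁻¹) (𝓝[<] ξmax) (𝓝 2) := by
    have := h.tendsto_sq_div_log.div h.tendsto_log_div_log one_ne_zero
    rw [div_one] at this
    refine this.congr' ?_
    filter_upwards [hL.eventually_gt_atTop 0] with ξ hξ
    simp only [Pi.div_apply]
    exact div_div_div_cancel_right₀ hξ.ne' _ _
  have hpos : ∀ᶠ ξ in 𝓝[<] ξmax, 0 < Real.log (ξmax - ξ)⁻¹ := by
    filter_upwards [h1.eventually_const_lt (show (0 : ℝ) < 2 by norm_num), h.eventually_mem]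
      with ξ h2 hξ
    exact (div_pos_iff_of_pos_left (by have := hξ.2.ne; positivity)).1 h2
  have h2 : Tendsto (fun ξ => deriv φ ξ / (-√2 * (Real.log (ξmax - ξ)⁻¹) ^ (1 / 2 : ℝ)))
      (𝓝[<] ξmax) (𝓝 1) := by
    have := h1.sqrt.div_const √2
    rw [div_self (by positivity)] at this
    refine this.congr' ?_
    filter_upwards [h.eventually_mem] with ξ hξ
    rw [Real.sqrt_div (sq_nonneg _), Real.sqrt_sq_eq_abs, abs_of_neg hξ.2, ← Real.sqrt_eq_rpow]
    rw [div_div, mul_comm, neg_mul, div_neg, neg_div]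
  refine ⟨√2, by positivity, ?_, ?_⟩
  · rw [isEquivalent_iff_tendsto_one]
    · have := h.tendsto_div_dist.mul h2
      rw [one_mul] at this
      refine this.congr' ?_
      filter_upwards [h.eventually_mem, hpos] with ξ hξ hp
      have hd : 0 < ξmax - ξ := sub_pos.2 hξ.1.2
      have hr : 0 < (Real.log (ξmax - ξ)⁻¹) ^ (1 / 2 : ℝ) := Real.rpow_pos_of_pos hp _
      have := hξ.2.ne
      simp only [Pi.div_apply]
      field_simp
    · filter_upwards [h.eventually_mem, hpos] with ξ hξ hp
      have hd : 0 < ξmax - ξ := sub_pos.2 hξ.1.2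
      have hr : 0 < (Real.log (ξmax - ξ)⁻¹) ^ (1 / 2 : ℝ) := Real.rpow_pos_of_pos hp _
      positivity
  · rw [isEquivalent_iff_tendsto_one]
    · exact h2
    · filter_upwards [hpos] with ξ hp
      have hr : 0 < (Real.log (ξmax - ξ)⁻¹) ^ (1 / 2 : ℝ) := Real.rpow_pos_of_pos hp _
      have h2 : 0 < √(2 : ℝ) := by positivity
      exact mul_ne_zero (neg_ne_zero.2 h2.ne') hr.ne'

end Rates

/-! ### From quenching waves to trajectories -/

section Forward

variable {c : ℝ} {φ : ℝ → ℝ} {a ξmax : ℝ}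

/-- Once the slope of a traveling wave is negative, it stays negative. -/
theorem IsTravelingWave.deriv_neg_of_le (h : IsTravelingWave c φ a ξmax) {ξ₁ ξ : ℝ}
    (h₁ : ξ₁ ∈ Ioo a ξmax) (hneg : deriv φ ξ₁ < 0) (hξ : ξ ∈ Ico ξ₁ ξmax) : deriv φ ξ < 0 := by
  -- Integrating factor: (e^{cξ}ψ)' = -e^{cξ}/φ < 0, so e^{cξ}ψ cannot return to zero.
  have hd : ∀ x ∈ Ioo a ξmax, HasDerivAt (fun y => Real.exp (c * y) * deriv φ y)
      (-(Real.exp (c * x) * (φ x)⁻¹)) x := fun x hx => by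
    have h3 : HasDerivAt (fun y => Real.exp (c * y)) (Real.exp (c * x) * c) x := by
      simpa using ((hasDerivAt_id x).const_mul c).exp
    refine (h3.mul (h.hasDerivAt hx).2).congr_deriv ?_
    ring
  have hanti : AntitoneOn (fun y => Real.exp (c * y) * deriv φ y) (Ioo a ξmax) := by
    apply antitoneOn_of_deriv_nonpos (convex_Ioo _ _)
      (fun x hx => (hd x hx).continuousAt.continuousWithinAt)
    · intro x hx
      rw [interior_Ioo] at hx
      exact (hd x hx).differentiableAt.differentiableWithinAt
    · intro x hx
      rw [interior_Ioo] at hx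
      rw [(hd x hx).deriv]
      have := h.pos x hx
      have : 0 < Real.exp (c * x) * (φ x)⁻¹ := by positivity
      linarith
  have h1 : Real.exp (c * ξ) * deriv φ ξ ≤ Real.exp (c * ξ₁) * deriv φ ξ₁ :=
    hanti h₁ ⟨h₁.1.trans_le hξ.1, hξ.2⟩ hξ.1
  have h2 : Real.exp (c * ξ₁) * deriv φ ξ₁ < 0 := mul_neg_of_pos_of_neg (Real.exp_pos _) hneg
  exact (pos_iff_neg_of_mul_neg (h1.trans_lt h2)).1 (Real.exp_pos _)

/-- Since 1/(φλ) = -ψ/φ = (-ln φ)', the new time is ln φ(ξ₁) - ln φ(ξ), which runs from 0 to ∞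
because φ → 0; the trajectory is (-1/ψ, -φ/ψ) composed with its inverse. -/
theorem IsQuenchingWave.exists_trajectory (h : IsQuenchingWave c φ a ξmax) {ξ₁ : ℝ}
    (h₁ : ξ₁ ∈ Ioo a ξmax) (hneg : deriv φ ξ₁ < 0) :
    ∃ (γ : ℝ → ℝ × ℝ) (τ : ℝ → ℝ),
      IsTrajectoryOn (desingField c) γ (Ici 0) ∧
      γ 0 = (-1 / deriv φ ξ₁, -φ ξ₁ / deriv φ ξ₁) ∧ γ 0 ∈ Wcs c ∧
      Tendsto γ atTop (𝓝 p₀) ∧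
      Corresponds φ ξ₁ ξmax γ τ := by
  have hw := h.toIsTravelingWave
  -- Starting slightly to the left of ξ₁ makes ξ₁ an interior point, so that the inverse of the time
  -- change is differentiable at τ = 0 too.
  obtain ⟨a', ha', hneg'⟩ : ∃ a' ∈ Ioo a ξ₁, deriv φ a' < 0 := by
    have e : ∀ᶠ y in 𝓝[<] ξ₁, deriv φ y < 0 :=
      ((hw.hasDerivAt h₁).2.continuousAt.eventually_lt_const hneg).filter_mono nhdsWithin_le_nhds
    obtain ⟨y, hy, hy'⟩ := (e.and (Ioo_mem_nhdsLT h₁.1)).exists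
    exact ⟨y, hy', hy⟩
  have hS : ∀ s ∈ Ioo a' ξmax, s ∈ Ioo a ξmax ∧ deriv φ s < 0 := fun s hs =>
    ⟨⟨ha'.1.trans hs.1, hs.2⟩, hw.deriv_neg_of_le ⟨ha'.1, ha'.2.trans h₁.2⟩ hneg' ⟨hs.1.le, hs.2⟩⟩
  have hξ₁ : ξ₁ ∈ Ioo a' ξmax := ⟨ha'.2, h₁.2⟩
  set F : ℝ → ℝ := fun ξ => Real.log (φ ξ₁) + -Real.log (φ ξ) with hF
  have hFd : ∀ s ∈ Ioo a' ξmax, HasDerivAt F (-(deriv φ s / φ s)) s := fun s hs =>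
    (h.hasDerivAt_neg_log (hS s hs).1).const_add _
  have hFd' : ∀ s ∈ Ioo a' ξmax, 0 < -(deriv φ s / φ s) := fun s hs =>
    neg_pos.2 (div_neg_of_neg_of_pos (hS s hs).2 (h.pos s (hS s hs).1))
  obtain ⟨hmono, g, hg, hgd⟩ := exists_hasDerivAt_inverse isOpen_Ioo ordConnected_Ioo hFd hFd'
  have hF1 : F ξ₁ = 0 := by simp [hF]
  have hFt : Tendsto F (𝓝[<] ξmax) atTop := tendsto_atTop_add_const_left _ _ h.tendsto_neg_log
  have hcont : ContinuousOn F (Ioo a' ξmax) := fun s hs =>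
    (hFd s hs).continuousAt.continuousWithinAt
  have hsurj : ∀ t, 0 ≤ t → ∃ s ∈ Ico ξ₁ ξmax, F s = t := by
    intro t ht
    obtain ⟨s, hs, hs'⟩ := ((hFt.eventually_ge_atTop t).and (Ioo_mem_nhdsLT h₁.2)).exists
    have hsub : Icc ξ₁ s ⊆ Ioo a' ξmax := fun y hy => ⟨ha'.2.trans_le hy.1, hy.2.trans_lt hs'.2⟩
    obtain ⟨y, hy, hy'⟩ := intermediate_value_Icc hs'.1.le (hcont.mono hsub)
      (show t ∈ Icc (F ξ₁) (F s) from ⟨by rwa [hF1], hs⟩)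
    exact ⟨y, ⟨hy.1, hy.2.trans_lt hs'.2⟩, hy'⟩
  have hgt : Tendsto g atTop (𝓝[<] ξmax) := by
    rw [tendsto_nhdsWithin_iff]
    have hmem : ∀ᶠ t in atTop, g t ∈ Iio ξmax := by
      filter_upwards [eventually_ge_atTop 0] with t ht
      obtain ⟨s, hs, rfl⟩ := hsurj t ht
      rw [hg s ⟨ha'.2.trans_le hs.1, hs.2⟩]
      exact hs.2
    refine ⟨tendsto_order.2 ⟨fun m hm => ?_, fun m hm => hmem.mono fun t ht => lt_trans ht hm⟩,
      hmem⟩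
    obtain ⟨m', hm', hm''⟩ := exists_between (max_lt hm h₁.2)
    have hm1 : m' ∈ Ioo a' ξmax := ⟨ha'.2.trans ((le_max_right _ _).trans_lt hm'), hm''⟩
    filter_upwards [eventually_ge_atTop 0, eventually_gt_atTop (F m')] with t ht ht'
    obtain ⟨s, hs, rfl⟩ := hsurj t ht
    have hs1 : s ∈ Ioo a' ξmax := ⟨ha'.2.trans_le hs.1, hs.2⟩
    rw [hg s hs1]
    exact ((le_max_left _ _).trans_lt hm').trans ((hmono.lt_iff_lt hm1 hs1).1 ht')
  set γ : ℝ → ℝ × ℝ := fun t => (-1 / deriv φ (g t), -φ (g t) / deriv φ (g t)) with hγ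
  have hγF : ∀ s ∈ Ioo a' ξmax, γ (F s) = (-1 / deriv φ s, -φ s / deriv φ s) := fun s hs => by
    simp only [hγ, hg s hs]
  have htraj : IsTrajectoryOn (desingField c) γ (Ici 0) := by
    intro t ht
    obtain ⟨s, hs, rfl⟩ := hsurj t ht
    have hs1 : s ∈ Ioo a' ξmax := ⟨ha'.2.trans_le hs.1, hs.2⟩
    obtain ⟨d1, d2⟩ := hw.hasDerivAt (hS s hs1).1
    have hψ := (hS s hs1).2.ne
    have hφ := (h.pos s (hS s hs1).1).ne'
    have hgs := hgd s hs1
    have d1' : HasDerivAt (fun t => φ (g t)) _ (F s) :=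
      HasDerivAt.comp (h₂ := φ) (F s) (by rw [hg s hs1]; exact d1) hgs
    have d2' : HasDerivAt (fun t => deriv φ (g t)) _ (F s) :=
      HasDerivAt.comp (h₂ := deriv φ) (F s) (by rw [hg s hs1]; exact d2) hgs
    have hψ' : deriv φ (g (F s)) ≠ 0 := by rwa [hg s hs1]
    have e1 := (hasDerivAt_const (F s) (-1 : ℝ)).div d2' hψ'
    have e2 := d1'.neg.div d2' hψ'
    refine ((e1.prodMk e2).congr_deriv ?_).hasDerivWithinAt
    simp only [hγF s hs1, desingField, hg s hs1, Pi.neg_apply]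
    ext
    · simp only
      field_simp
      ring
    · simp only
      field_simp
      ring
  have hlim : Tendsto γ atTop (𝓝 p₀) := by
    have hi := h.tendsto_inv_deriv.comp hgt
    have hφ := h.extinction.comp hgt
    have e1 := hi.const_mul (-1)
    have e2 := hφ.neg.mul hi
    simp only [mul_zero, neg_zero] at e1 e2
    exact e1.prodMk_nhds e2
  have hγ0 : γ 0 = (-1 / deriv φ ξ₁, -φ ξ₁ / deriv φ ξ₁) := by
    rw [← hF1]; exact hγF ξ₁ hξ₁
  refine ⟨γ, F, htraj, hγ0, ⟨γ, htraj, rfl, hlim⟩, hlim, ?_⟩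
  have hI : ∀ ξ ∈ Ioo ξ₁ ξmax, ξ ∈ Ioo a' ξmax := fun ξ hξ => ⟨ha'.2.trans hξ.1, hξ.2⟩
  refine ⟨?_, ?_, ?_, ?_, ?_, hFt⟩
  · intro ξ hξ
    rw [hγF ξ (hI ξ hξ)]
    exact div_pos_of_neg_of_neg (by norm_num) (hS ξ (hI ξ hξ)).2
  · intro ξ hξ
    have := (hS ξ (hI ξ hξ)).2.ne
    rw [hγF ξ (hI ξ hξ)]
    field_simp
  · intro ξ hξ
    have := (hS ξ (hI ξ hξ)).2.ne
    rw [hγF ξ (hI ξ hξ)]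
    field_simp
  · intro ξ hξ
    have := (hS ξ (hI ξ hξ)).2.ne
    have := (h.pos ξ (hS ξ (hI ξ hξ)).1).ne'
    refine (hFd ξ (hI ξ hξ)).congr_deriv ?_
    rw [hγF ξ (hI ξ hξ)]
    field_simp
  · have := (hFd ξ₁ hξ₁).continuousAt.tendsto
    rw [hF1] at this
    exact this.mono_left nhdsWithin_le_nhds

end Forward

/-! ### From trajectories to quenching waves -/

section General

variable {E : Type*} [NormedAddCommGroup E] [NormedSpace ℝ E]

/-- Trajectories of a `C¹` vector field are determined by their initial points. -/
theorem IsTrajectoryOn.eqOn_Ici [ProperSpace E] {v : E → E} (hv : ContDiff ℝ 1 v)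
    {γ₁ γ₂ : ℝ → E} (h₁ : IsTrajectoryOn v γ₁ (Ici 0)) (h₂ : IsTrajectoryOn v γ₂ (Ici 0))
    (h0 : γ₁ 0 = γ₂ 0) : EqOn γ₁ γ₂ (Ici 0) := by
  intro T hT
  have hc₁ : ContinuousOn γ₁ (Icc 0 T) := h₁.continuousOn.mono Icc_subset_Ici_self
  have hc₂ : ContinuousOn γ₂ (Icc 0 T) := h₂.continuousOn.mono Icc_subset_Ici_self
  -- The field is only locally Lipschitz: uniqueness is applied on [0, T] in a ball containing both
  -- compact arcs.
  obtain ⟨R, hR⟩ := ((isCompact_Icc.image_of_continuousOn hc₁).union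
    (isCompact_Icc.image_of_continuousOn hc₂)).isBounded.subset_closedBall 0
  obtain ⟨K, hK⟩ := hv.contDiffOn.exists_lipschitzOnWith one_ne_zero
    (convex_closedBall (0 : E) R) (isCompact_closedBall 0 R)
  have hsub : ∀ {t : ℝ}, t ∈ Ico 0 T → Ici t ⊆ Ici 0 := fun ht => Ici_subset_Ici.2 ht.1
  exact ODE_solution_unique_of_mem_Icc_right (v := fun _ => v) (s := fun _ => Metric.closedBall 0 R)
    (fun _ _ => hK) hc₁ (fun t ht => (h₁ t ht.1).mono (hsub ht))
    (fun t ht => hR (Or.inl ⟨t, Ico_subset_Icc_self ht, rfl⟩)) hc₂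
    (fun t ht => (h₂ t ht.1).mono (hsub ht))
    (fun t ht => hR (Or.inr ⟨t, Ico_subset_Icc_self ht, rfl⟩)) h0 ⟨hT, le_rfl⟩

end General

theorem contDiff_desingField (c : ℝ) {n : WithTop ℕ∞} : ContDiff ℝ n (desingField c) := by
  unfold desingField
  fun_prop

/-- Every trajectory starting on `Wcs c` tends to `p₀`. -/
theorem tendsto_of_mem_Wcs {c : ℝ} {γ : ℝ → ℝ × ℝ}
    (h : IsTrajectoryOn (desingField c) γ (Ici 0)) (h0 : γ 0 ∈ Wcs c) :
    Tendsto γ atTop (𝓝 p₀) := by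
  obtain ⟨γ', h', h0', hlim⟩ := h0
  refine hlim.congr' ?_
  filter_upwards [eventually_ge_atTop 0] with t ht
  exact h'.eqOn_Ici (contDiff_desingField c) h h0' ht

/-- A function on `[0, ∞)` with vanishing derivative is constant. -/
theorem eq_of_hasDerivWithinAt_zero {y : ℝ → ℝ} (hy : ∀ t ∈ Ici 0, HasDerivWithinAt y 0 (Ici 0) t)
    {t : ℝ} (ht : 0 ≤ t) : y t = y 0 :=
  constant_of_has_deriv_right_zero
    (fun s hs => ((hy s hs.1).continuousWithinAt).mono Icc_subset_Ici_self)
    (fun s hs => (hy s hs.1).mono (Ici_subset_Ici.2 hs.1)) t ⟨ht, le_rfl⟩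

/-- Solutions of a scalar linear equation `y' = k(t) y` keep their sign. -/
theorem pos_of_hasDerivWithinAt_mul {y k : ℝ → ℝ} (hk : ContinuousOn k (Ici 0))
    (hy : ∀ t ∈ Ici 0, HasDerivWithinAt y (k t * y t) (Ici 0) t) (h0 : 0 < y 0) {t : ℝ}
    (ht : 0 ≤ t) : 0 < y t := by
  -- Freezing k at k(0) for negative times gives a function continuous on ℝ, whose primitive A
  -- provides the integrating factor e^{-A}.
  set k' : ℝ → ℝ := fun t => k (max t 0) with hk'
  have hk'c : Continuous k' := hk.comp_continuous (by fun_prop) fun t => mem_Ici.2 (le_max_right _ _)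
  set A : ℝ → ℝ := fun t => ∫ s in (0 : ℝ)..t, k' s
  have hA : ∀ t, HasDerivAt A (k' t) t := fun t => (hk'c.integral_hasStrictDerivAt 0 t).hasDerivAt
  have hz : ∀ t ∈ Ici (0 : ℝ), HasDerivWithinAt (fun t => y t * Real.exp (-A t)) 0 (Ici 0) t := by
    intro t ht
    refine ((hy t ht).mul (hA t).neg.exp.hasDerivWithinAt).congr_deriv ?_
    have : k' t = k t := by simp only [hk', max_eq_left (show (0 : ℝ) ≤ t from ht)]
    rw [this, Pi.neg_apply]
    ring
  have := eq_of_hasDerivWithinAt_zero hz ht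
  have hp : 0 < y 0 * Real.exp (-A 0) := mul_pos h0 (Real.exp_pos _)
  rw [← this] at hp
  exact (pos_iff_pos_of_mul_pos hp).2 (Real.exp_pos _)

/-- Range and limits of the inverse of an increasing function on `(0, ∞)`. -/
theorem inverse_limits {F g : ℝ → ℝ} {A B : ℝ} (hmono : StrictMonoOn F (Ioi 0))
    (hc : ContinuousOn F (Ioi 0)) (h0 : Tendsto F (𝓝[>] 0) (𝓝 A)) (h1 : Tendsto F atTop (𝓝 B))
    (hg : ∀ s ∈ Ioi 0, g (F s) = s) :
    A < B ∧ (∀ y ∈ Ioo A B, 0 < g y ∧ F (g y) = y) ∧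
      Tendsto g (𝓝[>] A) (𝓝 0) ∧ Tendsto g (𝓝[<] B) atTop := by
  have hA : ∀ s, 0 < s → A < F s := by
    intro s hs
    -- Limits only yield A ≤ F(s / 2); the intermediate point s / 2 makes the inequality at s
    -- strict.
    have hs2 : F (s / 2) < F s := hmono (half_pos hs) hs (half_lt_self hs)
    refine lt_of_le_of_lt (le_of_tendsto h0 ?_) hs2
    filter_upwards [Ioo_mem_nhdsGT (half_pos hs)] with u hu
    exact (hmono hu.1 (half_pos hs) hu.2).le
  have hB : ∀ s, 0 < s → F s < B := by
    intro s hs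
    have hs1 : s + 1 ∈ Ioi (0 : ℝ) := by simp only [mem_Ioi]; linarith
    have hs2 : F s < F (s + 1) := hmono hs hs1 (by linarith)
    refine hs2.trans_le (ge_of_tendsto h1 ?_)
    filter_upwards [eventually_gt_atTop (s + 1)] with u hu
    exact (hmono hs1 (lt_trans hs1 hu) hu).le
  have hsurj : ∀ y ∈ Ioo A B, ∃ s ∈ Ioi 0, F s = y := by
    intro y hy
    obtain ⟨u, hu, hu0⟩ := ((h0.eventually_lt_const hy.1).and self_mem_nhdsWithin).exists
    obtain ⟨v, hv, huv⟩ := ((h1.eventually_const_lt hy.2).and (eventually_ge_atTop u)).exists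
    have hsub : Icc u v ⊆ Ioi 0 := fun z hz => lt_of_lt_of_le hu0 hz.1
    obtain ⟨s, hs, hs'⟩ := intermediate_value_Icc huv (hc.mono hsub) ⟨hu.le, hv.le⟩
    exact ⟨s, hsub hs, hs'⟩
  have hAB : A < B := (hA 1 one_pos).trans (hB 1 one_pos)
  have hpos : ∀ y ∈ Ioo A B, 0 < g y := by
    intro y hy
    obtain ⟨s, hs, rfl⟩ := hsurj y hy
    rw [hg s hs]; exact hs
  refine ⟨hAB, fun y hy => ⟨hpos y hy, ?_⟩, ?_, ?_⟩
  · obtain ⟨s, hs, rfl⟩ := hsurj y hy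
    rw [hg s hs]
  · rw [tendsto_order]
    refine ⟨fun m hm => ?_, fun m hm => ?_⟩
    · filter_upwards [Ioo_mem_nhdsGT hAB] with y hy using hm.trans (hpos y hy)
    · filter_upwards [Ioo_mem_nhdsGT (hA m hm)] with y hy
      obtain ⟨s, hs, rfl⟩ := hsurj y ⟨hy.1, hy.2.trans (hB m hm)⟩
      rw [hg s hs]
      exact (hmono.lt_iff_lt hs hm).1 hy.2
  · rw [tendsto_atTop]
    intro m
    have hm : 0 < max m 1 := one_pos.trans_le (le_max_right _ _)
    filter_upwards [Ioo_mem_nhdsLT (hB _ hm)] with y hy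
    obtain ⟨s, hs, rfl⟩ := hsurj y ⟨(hA _ hm).trans hy.1, hy.2⟩
    rw [hg s hs]
    exact (le_max_left _ _).trans ((hmono.lt_iff_lt hm hs).1 hy.1).le

/-- The parameter ξ is recovered by integrating dξ/dτ = φλ = x, and ξmax is its limit as τ → ∞;
inverting τ ↦ ξ gives the wave. -/
theorem exists_quenchingWave {c : ℝ} {γ : ℝ → ℝ × ℝ}
    (h : IsTrajectoryOn (desingField c) γ (Ici 0)) (hW : γ 0 ∈ Wcs c) (hl0 : 0 < (γ 0).1)
    (hx0 : 0 < (γ 0).2) (ξ₁ : ℝ) :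
    ∃ (ξmax : ℝ) (φ τ : ℝ → ℝ), IsQuenchingWave c φ ξ₁ ξmax ∧ Corresponds φ ξ₁ ξmax γ τ := by
  have hlim := tendsto_of_mem_Wcs h hW
  set l : ℝ → ℝ := fun t => (γ t).1 with hl
  set x : ℝ → ℝ := fun t => (γ t).2 with hx
  have hlt : Tendsto l atTop (𝓝 0) := (continuous_fst.tendsto _).comp hlim
  have hcl : ContinuousOn l (Ici 0) := continuous_fst.comp_continuousOn h.continuousOn
  have hcx : ContinuousOn x (Ici 0) := continuous_snd.comp_continuousOn h.continuousOn
  have hdl : ∀ t ∈ Ici (0 : ℝ),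
      HasDerivWithinAt l ((c * x t - l t ^ 2) * l t) (Ici 0) t := fun t ht =>
    ((hasFDerivAt_fst (p := γ t)).comp_hasDerivWithinAt t (h t ht)).congr_deriv (by
      simp [desingField, hl, hx]; ring)
  have hdx : ∀ t ∈ Ici (0 : ℝ),
      HasDerivWithinAt x ((-1 + c * x t - l t ^ 2) * x t) (Ici 0) t := fun t ht =>
    ((hasFDerivAt_snd (p := γ t)).comp_hasDerivWithinAt t (h t ht)).congr_deriv (by
      simp [desingField, hl, hx]; ring)
  have hlpos : ∀ t, 0 ≤ t → 0 < l t := fun t ht =>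
    pos_of_hasDerivWithinAt_mul (by fun_prop) hdl hl0 ht
  have hxpos : ∀ t, 0 ≤ t → 0 < x t := fun t ht =>
    pos_of_hasDerivWithinAt_mul (by fun_prop) hdx hx0 ht
  set r : ℝ := x 0 / l 0 with hr
  have hrpos : 0 < r := div_pos hx0 hl0
  -- The logarithmic derivatives of x and λ differ by exactly -1, so (x/λ)e^τ is conserved.
  have hratio : ∀ t, 0 ≤ t → x t = r * Real.exp (-t) * l t := by
    intro t ht
    have hz : ∀ t ∈ Ici (0 : ℝ), HasDerivWithinAt (fun t => x t / l t * Real.exp t) 0 (Ici 0) t := by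
      intro t ht
      have := (hlpos t ht).ne'
      refine (((hdx t ht).div (hdl t ht) this).mul
        (Real.hasDerivAt_exp t).hasDerivWithinAt).congr_deriv ?_
      simp only [Pi.div_apply]
      field_simp
      ring
    have h1 := eq_of_hasDerivWithinAt_zero hz ht
    simp only [Real.exp_zero, mul_one, ← hr] at h1
    have := (hlpos t ht).ne'
    rw [← h1, Real.exp_neg]
    field_simp
  set X : ℝ → ℝ := fun t => x (max t 0) with hX
  have hXc : Continuous X := hcx.comp_continuous (by fun_prop) fun t => mem_Ici.2 (le_max_right _ _)
  have hXeq : ∀ t, 0 ≤ t → X t = x t := fun t ht => by simp only [hX, max_eq_left ht]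
  -- Once λ < 1, x ≤ r e^{-τ}; this integrability is what makes ξmax finite.
  have hint : MeasureTheory.IntegrableOn X (Ioi 0) := by
    refine integrable_of_isBigO_exp_neg one_pos hXc.continuousOn ?_
    refine IsBigO.of_bound r ?_
    filter_upwards [eventually_ge_atTop 0, hlt.eventually_lt_const one_pos] with t ht hl1
    have := hlpos t ht
    rw [hXeq t ht, hratio t ht, Real.norm_of_nonneg (by positivity),
      Real.norm_of_nonneg (by positivity), neg_one_mul]
    exact mul_le_of_le_one_right (by positivity) hl1.le
  set F : ℝ → ℝ := fun t => ξ₁ + ∫ s in (0 : ℝ)..t, X s with hF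
  have hFd0 : ∀ t, HasDerivAt F (X t) t := fun t =>
    ((hXc.integral_hasStrictDerivAt 0 t).hasDerivAt).const_add _
  have hFd : ∀ t ∈ Ioi (0 : ℝ), HasDerivAt F (x t) t := fun t ht => by
    rw [← hXeq t (le_of_lt ht)]; exact hFd0 t
  obtain ⟨hmono, τ, hτ, hτd⟩ := exists_hasDerivAt_inverse isOpen_Ioi ordConnected_Ioi hFd
    fun t ht => hxpos t (le_of_lt ht)
  have hF0 : Tendsto F (𝓝[>] 0) (𝓝 ξ₁) := by
    have := (hFd0 0).continuousAt.tendsto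
    rw [show F 0 = ξ₁ by simp [hF]] at this
    exact this.mono_left nhdsWithin_le_nhds
  have hF1 : Tendsto F atTop (𝓝 (ξ₁ + ∫ s in Ioi 0, X s)) :=
    (MeasureTheory.intervalIntegral_tendsto_integral_Ioi 0 hint tendsto_id).const_add _
  obtain ⟨hlt1, hinv, hτ0, hτ1⟩ := inverse_limits hmono
    (fun t ht => (hFd t ht).continuousAt.continuousWithinAt) hF0 hF1 hτ
  set b := ξ₁ + ∫ s in Ioi 0, X s with hb
  have hτd' : ∀ ξ ∈ Ioo ξ₁ b, HasDerivAt τ (x (τ ξ))⁻¹ ξ := fun ξ hξ => by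
    have := hτd (τ ξ) (hinv ξ hξ).1
    rwa [(hinv ξ hξ).2] at this
  set φ : ℝ → ℝ := fun ξ => r * Real.exp (-τ ξ) with hφ
  have hxφ : ∀ ξ ∈ Ioo ξ₁ b, x (τ ξ) = φ ξ * l (τ ξ) := fun ξ hξ =>
    hratio _ (hinv ξ hξ).1.le
  have hφpos : ∀ ξ, 0 < φ ξ := fun ξ => mul_pos hrpos (Real.exp_pos _)
  have hφd : ∀ ξ ∈ Ioo ξ₁ b, HasDerivAt φ (-1 / l (τ ξ)) ξ := fun ξ hξ => by
    refine ((hτd' ξ hξ).neg.exp.const_mul r).congr_deriv ?_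
    have h1 := (hlpos _ (hinv ξ hξ).1.le).ne'
    have h2 := (hφpos ξ).ne'
    rw [hxφ ξ hξ, Pi.neg_apply]
    have : r * Real.exp (-τ ξ) = φ ξ := rfl
    rw [← mul_assoc, this]
    field_simp
  have hψd : ∀ ξ ∈ Ioo ξ₁ b, HasDerivAt (fun ξ => -1 / l (τ ξ))
      (-c * (-1 / l (τ ξ)) - (φ ξ)⁻¹) ξ := fun ξ hξ => by
    have h1 := (hlpos _ (hinv ξ hξ).1.le).ne'
    have h2 := (hφpos ξ).ne'
    have hd := ((hdl _ (hinv ξ hξ).1.le).hasDerivAt (Ici_mem_nhds (hinv ξ hξ).1)).comp ξ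
      (hτd' ξ hξ)
    refine ((hasDerivAt_const ξ (-1 : ℝ)).div hd h1).congr_deriv ?_
    simp only [Function.comp_apply, hxφ ξ hξ]
    field_simp
    ring
  have hdφ : ∀ ξ ∈ Ioo ξ₁ b, deriv φ ξ = -1 / l (τ ξ) := fun ξ hξ => (hφd ξ hξ).deriv
  refine ⟨b, φ, τ, ⟨isTravelingWave_of_hasDerivAt hlt1 (fun ξ _ => hφpos ξ) hφd hψd, ?_, ?_⟩,
    ⟨?_, ?_, hdφ, ?_, hτ0, hτ1⟩⟩
  · have := (Real.tendsto_exp_neg_atTop_nhds_zero.comp hτ1).const_mul r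
    rwa [mul_zero] at this
  · have hl' : Tendsto (fun ξ => l (τ ξ)) (𝓝[<] b) (𝓝[>] 0) := by
      refine tendsto_nhdsWithin_iff.2 ⟨hlt.comp hτ1, ?_⟩
      filter_upwards [Ioo_mem_nhdsLT hlt1] with ξ hξ using hlpos _ (hinv ξ hξ).1.le
    refine (tendsto_neg_atTop_atBot.comp (tendsto_inv_nhdsGT_zero.comp hl')).congr' ?_
    filter_upwards [Ioo_mem_nhdsLT hlt1] with ξ hξ
    rw [hdφ ξ hξ]
    simp [neg_div]
  · exact fun ξ hξ => hlpos _ (hinv ξ hξ).1.le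
  · intro ξ hξ
    have h1 := (hlpos _ (hinv ξ hξ).1.le).ne'
    exact (eq_div_iff h1).2 (hxφ ξ hξ).symm
  · intro ξ hξ
    have := hτd' ξ hξ
    rwa [hxφ ξ hξ, mul_inv] at this

/-! ### Global trajectories of bounded Lipschitz fields -/

section Existence

variable {E : Type*} [NormedAddCommGroup E] [NormedSpace ℝ E]

/-- A field bounded by L moves a point at most L n within time n, so Picard–Lindelöf applies on each
[0, n]; uniqueness glues the pieces. -/
theorem exists_isTrajectoryOn_Ici [CompleteSpace E] {v : E → E} {K L : NNReal}
    (hv : LipschitzWith K v) (hL : ∀ x, ‖v x‖ ≤ L) (x₀ : E) :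
    ∃ γ : ℝ → E, IsTrajectoryOn v γ (Ici 0) ∧ γ 0 = x₀ := by
  have hex : ∀ n : ℕ, ∃ α : ℝ → E, α 0 = x₀ ∧
      ∀ t ∈ Icc (0 : ℝ) n, HasDerivWithinAt α (v (α t)) (Icc 0 (n : ℝ)) t := by
    intro n
    have hpl : IsPicardLindelof (fun _ => v) (tmin := 0) (tmax := (n : ℝ))
        ⟨0, le_rfl, n.cast_nonneg⟩ x₀ (L * n) 0 L K :=
      { lipschitzOnWith := fun _ _ => hv.lipschitzOnWith
        continuousOn := fun _ _ => continuousOn_const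
        norm_le := fun _ _ x _ => hL x
        mul_max_le := by simp }
    exact hpl.exists_eq_forall_mem_Icc_hasDerivWithinAt₀
  choose α hα0 hα using hex
  have hcons : ∀ {m n : ℕ}, m ≤ n → EqOn (α m) (α n) (Icc 0 (m : ℝ)) := by
    intro m n hmn
    have hmn' : (m : ℝ) ≤ n := by exact_mod_cast hmn
    refine ODE_solution_unique (v := fun _ => v) (fun _ => hv)
      (fun t ht => (hα m t ht).continuousWithinAt) (fun t ht => ?_)
      (fun t ht => ((hα n t ⟨ht.1, ht.2.trans hmn'⟩).continuousWithinAt).mono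
        (Icc_subset_Icc_right hmn')) (fun t ht => ?_) (by rw [hα0, hα0])
    · exact (hα m t (Ico_subset_Icc_self ht)).mono_of_mem_nhdsWithin (Icc_mem_nhdsGE_of_mem ht)
    · have ht' : t ∈ Ico (0 : ℝ) n := ⟨ht.1, ht.2.trans_le hmn'⟩
      exact (hα n t (Ico_subset_Icc_self ht')).mono_of_mem_nhdsWithin (Icc_mem_nhdsGE_of_mem ht')
  have hcons' : ∀ (m n : ℕ) (s : ℝ), 0 ≤ s → s ≤ m → s ≤ n → α m s = α n s := by
    intro m n s h0 hm hn
    rcases le_total m n with h | h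
    · exact hcons h ⟨h0, hm⟩
    · exact (hcons h ⟨h0, hn⟩).symm
  -- The +1 keeps t strictly below the right end of the interval, so the chosen piece is a solution
  -- on a neighborhood of t in [0, ∞).
  refine ⟨fun t => α (⌈t⌉₊ + 1) t, fun t ht => ?_, hα0 _⟩
  have ht0 : (0 : ℝ) ≤ t := ht
  have hlt : ∀ s : ℝ, s < ((⌈s⌉₊ + 1 : ℕ) : ℝ) := fun s => by
    push_cast; linarith [Nat.le_ceil s]
  have hd := hα (⌈t⌉₊ + 1) t ⟨ht0, (hlt t).le⟩
  have hmem : Icc 0 ((⌈t⌉₊ + 1 : ℕ) : ℝ) ∈ 𝓝[Ici 0] t := by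
    refine mem_of_superset (inter_mem_nhdsWithin _ (Iio_mem_nhds (hlt t))) ?_
    exact fun s hs => ⟨hs.1, le_of_lt hs.2⟩
  refine (hd.mono_of_mem_nhdsWithin hmem).congr_of_eventuallyEq ?_ rfl
  filter_upwards [hmem] with s hs
  exact hcons' _ _ s hs.1 (hlt s).le hs.2

end Existence

/-! ### Asymptotic stability of `p₀` -/

/-- A Lyapunov function for the equilibrium `p₀`. -/
def lyapunov (c : ℝ) (q : ℝ × ℝ) : ℝ := q.1 ^ 2 + 2 * c ^ 2 * q.2 ^ 2

/-- The derivative of `lyapunov c` along `desingField c`. -/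
def lyapunovDeriv (c : ℝ) (q : ℝ × ℝ) : ℝ :=
  2 * q.1 * (desingField c q).1 + 4 * c ^ 2 * q.2 * (desingField c q).2

/-- With y = cx, V' + V²/2 = -(3/2)λ⁴ + 2yλ² - 4y² + 4y³ - 2y²λ² + 2y⁴. The indefinite term
satisfies 2yλ² ≤ λ⁴ + y², and |y| ≤ 1/2 bounds 4y³ + 2y⁴ by (5/2)y², so the damping -4y² wins. -/
theorem lyapunovDeriv_le {c : ℝ} {q : ℝ × ℝ} (hq : |c * q.2| ≤ 1 / 2) :
    lyapunovDeriv c q ≤ -(lyapunov c q ^ 2 / 2) := by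
  obtain ⟨l, x⟩ := q
  simp only [lyapunovDeriv, lyapunov, desingField] at *
  obtain ⟨h1, h2⟩ := abs_le.1 hq
  set y := c * x with hy
  have e1 : 2 * l * (y * l - l ^ 3) + 4 * c ^ 2 * x * (-x + x * (y - l ^ 2)) =
      2 * y * l ^ 2 - 2 * l ^ 4 + 4 * y ^ 2 * (-1 + y - l ^ 2) := by rw [hy]; ring
  have e2 : (l ^ 2 + 2 * c ^ 2 * x ^ 2) ^ 2 = (l ^ 2 + 2 * y ^ 2) ^ 2 := by rw [hy]; ring
  rw [e1, e2]
  nlinarith [sq_nonneg (y - l ^ 2), mul_nonneg (sq_nonneg y) (sub_nonneg.2 h2),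
    mul_nonneg (sq_nonneg y) (sq_nonneg l), mul_nonneg (sq_nonneg y) (sq_nonneg y),
    mul_nonneg (sq_nonneg y) (show 0 ≤ 1 / 2 + y by linarith),
    mul_nonneg (sq_nonneg y) (mul_nonneg (sub_nonneg.2 h2) (show 0 ≤ 1 / 2 + y by linarith))]

theorem hasDerivWithinAt_lyapunov {c : ℝ} {γ : ℝ → ℝ × ℝ} {v : ℝ × ℝ} {s : Set ℝ} {t : ℝ}
    (h : HasDerivWithinAt γ v s t) :
    HasDerivWithinAt (fun t => lyapunov c (γ t))
      (2 * (γ t).1 * v.1 + 4 * c ^ 2 * (γ t).2 * v.2) s t := by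
  have h1 : HasDerivWithinAt (fun t => (γ t).1) v.1 s t :=
    (hasFDerivAt_fst (p := γ t)).comp_hasDerivWithinAt t h
  have h2 : HasDerivWithinAt (fun t => (γ t).2) v.2 s t :=
    (hasFDerivAt_snd (p := γ t)).comp_hasDerivWithinAt t h
  refine ((h1.pow 2).add ((h2.pow 2).const_mul (2 * c ^ 2))).congr_deriv ?_
  simp only [Nat.cast_ofNat, Nat.add_one_sub_one, pow_one]
  ring

/-- A function on a convex set with nonpositive derivative is antitone. -/
theorem antitoneOn_of_hasDerivWithinAt_nonpos {f f' : ℝ → ℝ} {D : Set ℝ} (hD : Convex ℝ D)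
    (hf : ∀ t ∈ D, HasDerivWithinAt f (f' t) D t) (hf' : ∀ t ∈ D, f' t ≤ 0) :
    AntitoneOn f D := by
  have hi : ∀ t ∈ interior D, HasDerivAt f (f' t) t := fun t ht =>
    (hf t (interior_subset ht)).hasDerivAt (mem_interior_iff_mem_nhds.1 ht)
  refine antitoneOn_of_deriv_nonpos hD (fun t ht => (hf t ht).continuousWithinAt)
    (fun t ht => (hi t ht).differentiableAt.differentiableWithinAt) fun t ht => ?_
  rw [(hi t ht).deriv]
  exact hf' t (interior_subset ht)

/-- A nonnegative function on `[0, ∞)` with `f' ≤ -f² / 2` tends to zero. -/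
theorem tendsto_zero_of_deriv_le_sq {f f' : ℝ → ℝ} (h0 : ∀ t, 0 ≤ f t)
    (hf : ∀ t ∈ Ici 0, HasDerivWithinAt f (f' t) (Ici 0) t)
    (hf' : ∀ t ∈ Ici 0, f' t ≤ -(f t ^ 2 / 2)) : Tendsto f atTop (𝓝 0) := by
  have hanti : AntitoneOn f (Ici 0) :=
    antitoneOn_of_hasDerivWithinAt_nonpos (convex_Ici _) hf fun t ht =>
      (hf' t ht).trans (by have := sq_nonneg (f t); linarith)
  rw [tendsto_order]
  refine ⟨fun m hm => Eventually.of_forall fun t => hm.trans_le (h0 t), fun ε hε => ?_⟩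
  obtain ⟨T, hT0, hT⟩ : ∃ T ∈ Ici (0 : ℝ), f T < ε := by
    by_contra! hcon
    have hanti' : AntitoneOn (fun t => f t + ε ^ 2 / 2 * t) (Ici 0) :=
      antitoneOn_of_hasDerivWithinAt_nonpos (f' := fun t => f' t + ε ^ 2 / 2) (convex_Ici _)
        (fun t ht => by
          have := ((hasDerivAt_id t).const_mul (ε ^ 2 / 2)).hasDerivWithinAt (s := Ici 0)
          exact ((hf t ht).add this).congr_deriv (by rw [mul_one]))
        (fun t ht => by
          have h1 := hf' t ht
          have h2 : ε ^ 2 ≤ f t ^ 2 := pow_le_pow_left₀ hε.le (hcon t ht) 2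
          linarith)
    -- If f ≥ ε throughout, f decreases at rate at least ε²/2, hence by f(0) + 1 up to time T,
    -- contradicting f ≥ 0.
    set T := 2 * (f 0 + 1) / ε ^ 2 with hT
    have hT0 : 0 ≤ T := by have := h0 0; positivity
    have h1 : f T + ε ^ 2 / 2 * T ≤ f 0 + ε ^ 2 / 2 * 0 :=
      hanti' (mem_Ici.2 le_rfl) hT0 hT0
    have h2 : ε ^ 2 / 2 * T = f 0 + 1 := by rw [hT]; field_simp
    linarith [h0 T]
  filter_upwards [eventually_ge_atTop T] with t ht
  exact (hanti hT0 (le_trans hT0 ht) ht).trans_lt hT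

/-- A bump function makes the field bounded and Lipschitz, hence its trajectories global. V still
decreases, so those starting in a small sublevel set stay where the bump is 1 and solve (*); there
V' ≤ -V²/2 forces V → 0. -/
theorem Wcs_mem_nhds {c : ℝ} (hc : c ≠ 0) : Wcs c ∈ 𝓝 p₀ := by
  have hc' : 0 < |c| := abs_pos.2 hc
  set ρ : ℝ := 1 / (2 * |c|) with hρ
  have hρ0 : 0 < ρ := by positivity
  have hball : ∀ q : ℝ × ℝ, q ∈ Metric.closedBall 0 ρ → |c * q.2| ≤ 1 / 2 := by
    intro q hq
    have h1 : |q.2| ≤ ρ := (norm_snd_le q).trans (by simpa using hq)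
    rw [abs_mul]
    calc |c| * |q.2| ≤ |c| * ρ := by gcongr
      _ = 1 / 2 := by rw [hρ]; field_simp
  let χ : ContDiffBump (0 : ℝ × ℝ) := ⟨ρ / 2, ρ, by positivity, by linarith⟩
  set v : ℝ × ℝ → ℝ × ℝ := fun q => χ q • desingField c q with hv
  have hvC : ContDiff ℝ 1 v := χ.contDiff.smul (contDiff_desingField c)
  have hvs : HasCompactSupport v := χ.hasCompactSupport.smul_right
  obtain ⟨K, hK⟩ := hvC.lipschitzWith_of_hasCompactSupport hvs one_ne_zero
  obtain ⟨B, hB⟩ := hvs.exists_bound_of_continuous hvC.continuous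
  have hB' : ∀ q, ‖v q‖ ≤ (B.toNNReal : ℝ) := fun q => (hB q).trans (Real.le_coe_toNNReal B)
  have hdec : ∀ q, χ q * lyapunovDeriv c q ≤ 0 := by
    intro q
    by_cases hq : q ∈ Metric.closedBall 0 ρ
    · have h1 := lyapunovDeriv_le (hball q hq)
      have h2 := sq_nonneg (lyapunov c q)
      exact mul_nonpos_of_nonneg_of_nonpos χ.nonneg (by linarith)
    · have : χ q = 0 := χ.zero_of_le_dist (by
        simp only [Metric.mem_closedBall, not_le] at hq; exact hq.le)
      simp [this]
  -- The two entries bound |λ| and |x| separately by ρ / 2, the radius of the ball (in the sup norm)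
  -- on which the bump is 1.
  set η : ℝ := min ((ρ / 2) ^ 2) (2 * c ^ 2 * (ρ / 2) ^ 2) with hη
  have hη0 : 0 < η := by have := hc; positivity
  have hsub : ∀ q, lyapunov c q < η → q ∈ Metric.closedBall (0 : ℝ × ℝ) (ρ / 2) := by
    intro q hq
    have h1 : lyapunov c q < (ρ / 2) ^ 2 := hq.trans_le (min_le_left _ _)
    have h2 : lyapunov c q < 2 * c ^ 2 * (ρ / 2) ^ 2 := hq.trans_le (min_le_right _ _)
    unfold lyapunov at h1 h2
    have h3 : 0 ≤ 2 * c ^ 2 * q.2 ^ 2 := by positivity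
    have h4 : 0 < 2 * c ^ 2 := by positivity
    have h5 : q.2 ^ 2 ≤ (ρ / 2) ^ 2 := by
      refine le_of_mul_le_mul_left ?_ h4
      linarith [sq_nonneg q.1]
    rw [mem_closedBall_zero_iff, Prod.norm_def]
    exact max_le (abs_le_of_sq_le_sq (by linarith) (by positivity))
      (abs_le_of_sq_le_sq h5 (by positivity))
  have hVc : Continuous (lyapunov c) := by unfold lyapunov; fun_prop
  have hnhds : ∀ᶠ q in 𝓝 p₀, lyapunov c q < η :=
    hVc.continuousAt.eventually_lt_const (by simpa [lyapunov, p₀] using hη0)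
  filter_upwards [hnhds] with q hq
  obtain ⟨γ, hγ, rfl⟩ := exists_isTrajectoryOn_Ici hK hB' q
  have hd : ∀ t ∈ Ici (0 : ℝ), HasDerivWithinAt (fun t => lyapunov c (γ t))
      (χ (γ t) * lyapunovDeriv c (γ t)) (Ici 0) t := fun t ht =>
    (hasDerivWithinAt_lyapunov (hγ t ht)).congr_deriv (by
      simp only [hv, Prod.smul_fst, Prod.smul_snd, smul_eq_mul, lyapunovDeriv]; ring)
  have hanti : AntitoneOn (fun t => lyapunov c (γ t)) (Ici 0) :=
    antitoneOn_of_hasDerivWithinAt_nonpos (convex_Ici _) hd fun t _ => hdec _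
  have hmem : ∀ t ∈ Ici (0 : ℝ), γ t ∈ Metric.closedBall (0 : ℝ × ℝ) (ρ / 2) := fun t ht =>
    hsub _ ((hanti (mem_Ici.2 le_rfl) ht ht).trans_lt hq)
  have hχ : ∀ t ∈ Ici (0 : ℝ), χ (γ t) = 1 := fun t ht => χ.one_of_mem_closedBall (hmem t ht)
  have htraj : IsTrajectoryOn (desingField c) γ (Ici 0) := fun t ht =>
    (hγ t ht).congr_deriv (by simp only [hv, hχ t ht, one_smul])
  have hV : Tendsto (fun t => lyapunov c (γ t)) atTop (𝓝 0) := by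
    refine tendsto_zero_of_deriv_le_sq (fun t => by unfold lyapunov; positivity) hd
      fun t ht => ?_
    rw [hχ t ht, one_mul]
    exact lyapunovDeriv_le (hball _ (Metric.closedBall_subset_closedBall (by linarith) (hmem t ht)))
  refine ⟨γ, htraj, rfl, ?_⟩
  have h1 : Tendsto (fun t => (γ t).1) atTop (𝓝 0) := by
    have := hV.sqrt
    rw [Real.sqrt_zero] at this
    refine squeeze_zero_norm (fun t => ?_) this
    refine Real.abs_le_sqrt ?_
    have : 0 ≤ 2 * c ^ 2 * (γ t).2 ^ 2 := by positivity
    unfold lyapunov; linarith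
  have h2 : Tendsto (fun t => (γ t).2) atTop (𝓝 0) := by
    have := (hV.div_const (2 * c ^ 2)).sqrt
    rw [zero_div, Real.sqrt_zero] at this
    refine squeeze_zero_norm (fun t => ?_) this
    refine Real.abs_le_sqrt ?_
    rw [le_div_iff₀ (by positivity)]
    unfold lyapunov; linarith [sq_nonneg (γ t).1]
  exact h1.prodMk_nhds h2

/-! ### The linearization at `p₀` -/

theorem hasFDerivAt_desingField (c : ℝ) :
    HasFDerivAt (desingField c)
      ((0 : ℝ →L[ℝ] ℝ).prodMap (-ContinuousLinearMap.id ℝ ℝ)) p₀ := by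
  have h1 : HasFDerivAt (fun q : ℝ × ℝ => q.1) (ContinuousLinearMap.fst ℝ ℝ ℝ) p₀ :=
    hasFDerivAt_fst
  have h2 : HasFDerivAt (fun q : ℝ × ℝ => q.2) (ContinuousLinearMap.snd ℝ ℝ ℝ) p₀ :=
    hasFDerivAt_snd
  have e1 := ((h2.const_mul c).mul h1).sub (h1.pow 3)
  have e2 := h2.neg.add (h2.mul ((h2.const_mul c).sub (h1.pow 2)))
  refine (e1.prodMk e2).congr_fderiv ?_
  ext <;> simp [p₀]

theorem fderiv_desingField (c : ℝ) :
    ((fderiv ℝ (desingField c) p₀ : ℝ × ℝ →L[ℝ] ℝ × ℝ) : ℝ × ℝ →ₗ[ℝ] ℝ × ℝ) =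
      (0 : ℝ →ₗ[ℝ] ℝ).prodMap (-LinearMap.id) := by
  rw [(hasFDerivAt_desingField c).fderiv]
  rfl

theorem isSemiHyperbolic_p₀ (c : ℝ) : IsSemiHyperbolic (desingField c) p₀ := by
  refine ⟨by simp [desingField, p₀], (contDiff_desingField c).contDiffAt, ?_⟩
  have hm : LinearMap.toMatrix (Module.Basis.finTwoProd ℝ) (Module.Basis.finTwoProd ℝ)
      ((0 : ℝ →ₗ[ℝ] ℝ).prodMap (-LinearMap.id)) = !![0, 0; 0, -1] := by
    ext i j
    fin_cases i <;> fin_cases j <;> simp [LinearMap.toMatrix_apply]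
  have hp : (X : ℝ[X]) * (X + C 1) ≠ 0 := mul_ne_zero X_ne_zero (X_add_C_ne_zero 1)
  have hcp : LinearMap.charpoly ((0 : ℝ →ₗ[ℝ] ℝ).prodMap (-LinearMap.id (R := ℝ) (M := ℝ))) =
      (X : ℝ[X]) * (X + C 1) := by
    rw [← LinearMap.charpoly_toMatrix _ (Module.Basis.finTwoProd ℝ), hm, Matrix.charpoly_fin_two]
    simp [Matrix.trace_fin_two, Matrix.det_fin_two]
    ring
  rw [fderiv_desingField, hcp, rootMultiplicity_mul hp,
    rootMultiplicity_eq_zero (p := X + C (1 : ℝ)) (by simp)]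
  have := rootMultiplicity_X_sub_C_self (x := (0 : ℝ))
  simpa using this

/-- The single polynomial X(X + 1), with roots 0 and -1, annihilates diag(0, -1), so its kernel is
already everything. -/
theorem centerStableSubspace_desingField (c : ℝ) :
    centerStableSubspace
      ((fderiv ℝ (desingField c) p₀ : ℝ × ℝ →L[ℝ] ℝ × ℝ) : ℝ × ℝ →ₗ[ℝ] ℝ × ℝ) = ⊤ := by
  rw [fderiv_desingField, eq_top_iff]
  have hp : (X : ℝ[X]) * (X + C 1) ≠ 0 := mul_ne_zero X_ne_zero (X_add_C_ne_zero 1)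
  have hroot : ∀ z : ℂ, aeval z ((X : ℝ[X]) * (X + C 1)) = 0 → z.re ≤ 0 := by
    intro z hz
    simp only [map_mul, map_add, aeval_X, map_one, mul_eq_zero] at hz
    rcases hz with rfl | hz
    · simp
    · rw [eq_neg_of_add_eq_zero_left hz]; simp
  refine le_trans (fun w _ => ?_) (le_iSup_of_le ((X : ℝ[X]) * (X + C 1))
    (le_iSup_of_le hp (le_iSup_of_le hroot le_rfl)))
  rw [LinearMap.mem_ker]
  ext <;> simp [Module.End.mul_apply]

/-! ### Center-stable manifolds when there is no unstable direction -/

section NoUnstable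

variable {E : Type*} [NormedAddCommGroup E] [NormedSpace ℝ E] {g : E → E} {p : E} {W : Set E}

/-- A complement of the whole space is zero, so the graph condition holds at every point near p. -/
theorem IsCenterStableManifold.mem_nhds (hW : IsCenterStableManifold g p W)
    (htop : centerStableSubspace (fderiv ℝ g p : E →ₗ[ℝ] E) = ⊤) : W ∈ 𝓝 p := by
  obtain ⟨-, -, ⟨Q, h, hQ, -, -, -, hgraph⟩, -⟩ := hW
  have hbot : Q = ⊥ := by
    rw [htop] at hQ
    exact top_disjoint.1 hQ.disjoint
  filter_upwards [hgraph] with q hq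
  refine hq.2 ⟨⟨q - p, by rw [htop]; trivial⟩, ?_⟩
  have h0 : ∀ w : Q, (w : E) = 0 := fun w =>
    (Submodule.mem_bot ℝ).1 (hbot.le w.2)
  rw [h0]
  simp

/-- The graph is that of the zero map into the zero space, and local invariance is tautological when
W itself is taken as the neighborhood. -/
theorem isCenterStableManifold_of_mem_nhds (hg : g p = 0)
    (htop : centerStableSubspace (fderiv ℝ g p : E →ₗ[ℝ] E) = ⊤) (hW : W ∈ 𝓝 p) :
    IsCenterStableManifold g p W := by
  refine ⟨hg, mem_of_mem_nhds hW, ⟨⊥, fun _ => 0, ?_, contDiffAt_const, rfl, ?_, ?_⟩,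
    W, hW, fun γ T _ _ _ h => h⟩
  · rw [htop]; exact isCompl_top_bot
  · exact fderiv_const_apply _
  · filter_upwards [hW] with q hq
    exact ⟨fun _ => ⟨⟨q - p, by rw [htop]; trivial⟩, by simp⟩, fun _ => hq⟩

end NoUnstable

/-! ### Quenching of the profile and of the solution -/

/-- For c < 0 the map t ↦ x₀ - ct is an increasing homeomorphism, so t ↑ T is the same as ξ ↑ x₀ -
cT. -/
theorem map_sub_mul_nhdsLT {c : ℝ} (hc : c < 0) (T x₀ : ℝ) :
    map (fun t => x₀ - c * t) (𝓝[<] T) = 𝓝[<] (x₀ - c * T) := by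
  have hc0 : -c ≠ 0 := by linarith
  let e : ℝ ≃ₜ ℝ := (Homeomorph.mulLeft₀ (-c) hc0).trans (Homeomorph.addLeft x₀)
  have he : (fun t => x₀ - c * t) = e := by
    funext t
    simp [e, sub_eq_add_neg]
  rw [he, e.isEmbedding.map_nhdsWithin_eq, ← he]
  congr 1
  ext y
  constructor
  · rintro ⟨t, ht, rfl⟩
    have : t < T := ht
    simp only [mem_Iio]
    nlinarith
  · intro hy
    have hy' : y < x₀ - c * T := hy
    have hc1 := hc.ne
    refine ⟨(x₀ - y) / c, ?_, by simp only; field_simp; ring⟩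
    rw [mem_Iio, div_lt_iff_of_neg hc]
    linarith

theorem quenchesAt_iff {c : ℝ} (hc : c < 0) (φ : ℝ → ℝ) (T x₀ : ℝ) :
    QuenchesAt (fun t x => φ (x - c * t)) T x₀ ↔
      Tendsto φ (𝓝[<] (x₀ - c * T)) (𝓝 0) ∧ Tendsto (deriv φ) (𝓝[<] (x₀ - c * T)) atBot := by
  have hd : (fun t => deriv (fun s => φ (x₀ - c * s)) t) =
      fun t => -c * deriv φ (x₀ - c * t) := by
    funext t
    have h1 := deriv_comp_mul_left c (fun y => φ (x₀ - y)) t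
    rw [h1, deriv_comp_const_sub, smul_eq_mul]
    ring
  unfold QuenchesAt
  rw [← map_sub_mul_nhdsLT hc, tendsto_map'_iff, tendsto_map'_iff, hd,
    tendsto_const_mul_atBot_of_pos (neg_pos.2 hc)]
  rfl

theorem isQuenchingWave_iff {c : ℝ} (hc : c < 0) {φ : ℝ → ℝ} {a ξmax : ℝ}
    (h : IsTravelingWave c φ a ξmax) :
    IsQuenchingWave c φ a ξmax ↔
      ∀ T x₀ : ℝ, x₀ - c * T = ξmax → QuenchesAt (fun t x => φ (x - c * t)) T x₀ := by
  constructor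
  · rintro hq T x₀ rfl
    exact (quenchesAt_iff hc φ T x₀).2 ⟨hq.extinction, hq.blowup⟩
  · intro hq
    -- One point of the line suffices, here T = 0 and x₀ = ξmax.
    have h0 := (quenchesAt_iff hc φ 0 ξmax).1 (hq 0 ξmax (by simp))
    rw [mul_zero, sub_zero] at h0
    exact ⟨h, h0.1, h0.2⟩

end QuenchingWave

theorem mainTheorem4 (c : ℝ) (hc : c ≠ 0) :
    -- `p₀` is semi-hyperbolic, and `Wcs c` is its center-stable manifold (unique near `p₀`)
    (IsSemiHyperbolic (desingField c) p₀ ∧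
      IsCenterStableManifold (desingField c) p₀ (Wcs c) ∧
      ∀ W : Set (ℝ × ℝ), IsCenterStableManifold (desingField c) p₀ W →
        ∀ᶠ q in 𝓝 p₀, q ∈ W ↔ q ∈ Wcs c) ∧
    -- quenching of the profile is quenching of `u(t,x) = φ(x - c t)` on the line `x - c t = ξmax`,
    -- when the wave moves so that this line is reached forward in time
    (c < 0 → ∀ (φ : ℝ → ℝ) (a ξmax : ℝ), IsTravelingWave c φ a ξmax →
      (IsQuenchingWave c φ a ξmax ↔
        ∀ T x₀ : ℝ, x₀ - c * T = ξmax → QuenchesAt (fun t x => φ (x - c * t)) T x₀)) ∧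
    -- every quenching traveling wave comes from a trajectory with initial data on `Wcs c`
    (∀ (φ : ℝ → ℝ) (a ξmax : ℝ), IsQuenchingWave c φ a ξmax →
      ∀ ξ₁ ∈ Ioo a ξmax, deriv φ ξ₁ < 0 →
        ∃ (γ : ℝ → ℝ × ℝ) (τ : ℝ → ℝ),
          IsTrajectoryOn (desingField c) γ (Ici 0) ∧
          γ 0 = (-1 / deriv φ ξ₁, -φ ξ₁ / deriv φ ξ₁) ∧ γ 0 ∈ Wcs c ∧
          Tendsto γ atTop (𝓝 p₀) ∧
          Corresponds φ ξ₁ ξmax γ τ) ∧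
    -- every trajectory with initial data on `Wcs c` (and `φ > 0`, `ψ < 0`) gives a quenching wave
    (∀ γ : ℝ → ℝ × ℝ, IsTrajectoryOn (desingField c) γ (Ici 0) →
      γ 0 ∈ Wcs c → 0 < (γ 0).1 → 0 < (γ 0).2 →
        ∀ ξ₁ : ℝ, ∃ (ξmax : ℝ) (φ τ : ℝ → ℝ),
          IsQuenchingWave c φ ξ₁ ξmax ∧ Corresponds φ ξ₁ ξmax γ τ) ∧
    -- the quenching rates
    (∀ (φ : ℝ → ℝ) (a ξmax : ℝ), IsQuenchingWave c φ a ξmax →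
      ∃ C : ℝ, 0 < C ∧
        φ ~[𝓝[<] ξmax]
          (fun ξ => C * (ξmax - ξ) * (Real.log (ξmax - ξ)⁻¹) ^ (1 / 2 : ℝ)) ∧
        deriv φ ~[𝓝[<] ξmax]
          (fun ξ => -C * (Real.log (ξmax - ξ)⁻¹) ^ (1 / 2 : ℝ))) := by
  refine ⟨⟨isSemiHyperbolic_p₀ c, isCenterStableManifold_of_mem_nhds ?_
      (centerStableSubspace_desingField c) (Wcs_mem_nhds hc), fun W hW => ?_⟩,
    fun hc' φ a ξmax h => isQuenchingWave_iff hc' h,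
    fun φ a ξmax h ξ₁ h₁ hneg => h.exists_trajectory h₁ hneg,
    fun γ h hW hl hx ξ₁ => exists_quenchingWave h hW hl hx ξ₁,
    fun φ a ξmax h => h.isEquivalent⟩
  · exact (isSemiHyperbolic_p₀ c).1
  · filter_upwards [hW.mem_nhds (centerStableSubspace_desingField c), Wcs_mem_nhds hc]
      with q h1 h2
    exact ⟨fun _ => h2, fun _ => h1⟩
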